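/- Let $B_l$ be the Bernoulli numbers, $\frac{x}{e^x-1}=\sum_{l\ge 0}\frac{B_l}{l!}x^l$ (so $B_1=-\tfrac12$), and let $S_k^{(1)}(l)$ be the (signed) Stirling numbers of the first kind, defined by $$x(x+1)\cdots(x+k-1)=(-1)^k\sum_{l=0}^{k}(-1)^l S_k^{(1)}(l)\,x^l .$$ For $k\ge 1$ put $$a_k=(-1)^{k+1}\sum_{l=1}^{k}(-1)^l\frac{(2l+1)!!}{2^{l+1}(l+1)!}B_{l+1}S_k^{(1)}(l),\qquad b_k=(-1)^{k+1}\sum_{l=1}^{k}(-1)^l\frac{(2l-1)!!}{2^{l}\,l!}B_{l}S_k^{(1)}(l).$$ Then for every natural number $n\ge 1$ the two series below converge absolutely, and $$\sum_{k=1}^{n}\frac{1}{k\sqrt{k}}=\zeta\!\left(\tfrac32\right)-\frac{2}{\sqrt n}+\frac{1}{2n\sqrt n}+\frac{2}{\sqrt n}\sum_{k=1}^{\infty}\frac{a_k}{n(n+1)(n+2)\cdots(n+k)}$$ and $$\sum_{k=1}^{n}\frac{1}{k\sqrt{k}}=\zeta\!\left(\tfrac32\right)-\frac{2}{\sqrt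 n}+2\sum_{k=1}^{\infty}\frac{b_k}{\sqrt n\,(n+1)(n+2)\cdots(n+k)} .$$ The first coefficients are $2a_1=-\frac18$, $2a_2=-\frac18$, $2a_3=-\frac{89}{384}$, $2a_4=-\frac{41}{64}$ and $2b_1=\frac12$, $2b_2=\frac38$, $2b_3=\frac58$, $2b_4=\frac{631}{384}$. -/

import Mathlib

open scoped Nat

/-- The (signed) Stirling number of the first kind `S_k^{(1)}(l)`, where
`x (x+1) ⋯ (x+k-1) = (-1)^k ∑_{l=0}^k (-1)^l S_k^{(1)}(l) x^l`
(see `prod_eq_sum_stirlingFirstSigned`). -/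
def stirlingFirstSigned (k l : ℕ) : ℤ :=
  (-1) ^ (k + l) * (Nat.stirlingFirst k l : ℤ)

theorem sum_stirlingFirst_mul_pow {R : Type*} [CommRing R] (k : ℕ) (x : R) :
    ∑ l ∈ Finset.range (k + 1), (Nat.stirlingFirst k l : R) * x ^ l =
      ∏ i ∈ Finset.range k, (x + (i : R)) := by
  induction k with
  | zero => simp
  | succ k ih =>
    have h : ∑ l ∈ Finset.range (k + 1), (Nat.stirlingFirst k (l + 1) : R) * x ^ (l + 1) * (k : R) =
        (∑ l ∈ Finset.range (k + 1), (Nat.stirlingFirst k l : R) * x ^ l) * (k : R) := by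
      rw [← Finset.sum_mul, Finset.sum_range_succ,
        Finset.sum_range_succ' (fun l => (Nat.stirlingFirst k l : R) * x ^ l)]
      rw [Nat.stirlingFirst_eq_zero_of_lt (Nat.lt_succ_self k)]
      cases k <;> simp [add_mul]
    rw [Finset.prod_range_succ, ← ih, mul_add, ← h, Finset.sum_range_succ', Finset.sum_mul,
      ← Finset.sum_add_distrib]
    simp only [Nat.stirlingFirst_succ_zero, Nat.cast_zero, zero_mul, add_zero]
    refine Finset.sum_congr rfl fun l _ => ?_
    rw [Nat.stirlingFirst_succ_succ]
    push_cast
    ring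

/-- The identity that characterises the signed Stirling numbers of the first kind. -/
theorem prod_eq_sum_stirlingFirstSigned {R : Type*} [CommRing R] (k : ℕ) (x : R) :
    ∏ i ∈ Finset.range k, (x + (i : R)) =
      (-1) ^ k * ∑ l ∈ Finset.range (k + 1),
        (-1) ^ l * ((stirlingFirstSigned k l : ℤ) : R) * x ^ l := by
  rw [← sum_stirlingFirst_mul_pow, Finset.mul_sum]
  refine Finset.sum_congr rfl fun l _ => ?_
  have h1 : ((-1 : R) ^ k) * (-1) ^ k = 1 := by rw [← mul_pow]; simp
  have h2 : ((-1 : R) ^ l) * (-1) ^ l = 1 := by rw [← mul_pow]; simp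
  simp only [stirlingFirstSigned, Int.cast_mul, Int.cast_pow, Int.cast_neg, Int.cast_one,
    Int.cast_natCast, pow_add]
  linear_combination (-(Nat.stirlingFirst k l : R) * x ^ l * (-1) ^ k * (-1) ^ k) * h2 -
    (Nat.stirlingFirst k l : R) * x ^ l * h1

/-- `(-1)^{k+1} ∑_{l=1}^k (-1)^l (2l+1)!! / (2^{l+1} (l+1)!) B_{l+1} S_k^{(1)}(l)`,
with `B_1 = -1/2`. -/
def zetaThreeHalvesCoeffA (k : ℕ) : ℚ :=
  (-1) ^ (k + 1) * ∑ l ∈ Finset.Icc 1 k,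
    (-1) ^ l * (((2 * l + 1)‼ : ℚ) / (2 ^ (l + 1) * ((l + 1)! : ℚ))) *
      bernoulli (l + 1) * (stirlingFirstSigned k l : ℚ)

/-- `(-1)^{k+1} ∑_{l=1}^k (-1)^l (2l-1)!! / (2^l l!) B_l S_k^{(1)}(l)`, with `B_1 = -1/2`. -/
def zetaThreeHalvesCoeffB (k : ℕ) : ℚ :=
  (-1) ^ (k + 1) * ∑ l ∈ Finset.Icc 1 k,
    (-1) ^ l * (((2 * l - 1)‼ : ℚ) / (2 ^ l * (l ! : ℚ))) *
      bernoulli l * (stirlingFirstSigned k l : ℚ)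

/-- The term of index `k` of the first series:
`zetaThreeHalvesCoeffA k / (n (n+1) (n+2) ⋯ (n+k))`. -/
noncomputable def zetaThreeHalvesTermA (n k : ℕ) : ℝ :=
  (zetaThreeHalvesCoeffA k : ℝ) / ((n : ℝ) * ∏ i ∈ Finset.Icc 1 k, ((n : ℝ) + (i : ℝ)))

/-- The term of index `k` of the second series:
`zetaThreeHalvesCoeffB k / (√n (n+1) (n+2) ⋯ (n+k))`. -/
noncomputable def zetaThreeHalvesTermB (n k : ℕ) : ℝ :=
  (zetaThreeHalvesCoeffB k : ℝ) / (√(n : ℝ) * ∏ i ∈ Finset.Icc 1 k, ((n : ℝ) + (i : ℝ)))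

/-!
Expand `v / (1 - e ^ (-v))` at `v = -s log (1 - x)`, where `0 < s ≤ 1`, as `∑ u_k(s) x ^ k`. Putting
`x = 1 - e ^ (-t)`, multiplying by `e ^ (-a t)` and integrating over `t > 0` gives
`∑ u_k(s) W_k = ∫ s t e ^ (-a t) / (1 - e ^ (-s t)) dt = ∑ s / (a + m s) ^ 2`, where
`W_k = k! / (a (a + 1) ⋯ (a + k))` is the Beta integral `B(a, k + 1)`. Now average over the arcsine
law `Beta (1/2, 1/2)` of `s`: its moments are `(2 l - 1)!! / (2 ^ l l!)`, so `u_k` becomes a sum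
over Stirling and Bernoulli numbers, and Feynman's parametrization turns `s / (a + m s) ^ 2` into
`1 / (2 √a (a + m) ^ (3/2))`. At `a = n` the right-hand side is a tail of `ζ(3/2)`. This is the
second series, up to the sign of `B_1`, which accounts for `∑ W_k / k = 1 / a ^ 2`. The first one
follows by summation by parts, its coefficients being `(k + 1) u_{k+1} - k u_k` up to a factor
`-k!`.

Every exchange of limits rests on `0 ≤ u_{k+1} ≤ u_k`. In terms of the reciprocal
`(1 - e ^ (-v)) / v = ∫ (1 - x) ^ (s y) dy`, over `0 ≤ y ≤ 1`, nonnegativity holds because the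
coefficients of this series after the first are nonpositive, and monotonicity is Kaluza's theorem
for the series of its partial sums, whose coefficients are log-convex.
-/

section FormalPowerSeries

open PowerSeries

variable {K : Type*} [Field K]

/-- The power series `-log (1 - X) = ∑ X ^ k / k`; its constant coefficient is `0⁻¹ = 0`. -/
def negLogOneSub (K : Type*) [Field K] : K⟦X⟧ :=
  PowerSeries.mk fun k => (k : K)⁻¹

/-- The coefficients `(1 / k!) ∑ c(k, l) h l` of the series obtained by substituting
`-log (1 - X)` for `Y` in the exponential generating function `∑ h l * Y ^ l / l!`. -/
def stirlingTransform (h : ℕ → K) (k : ℕ) : K :=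
  (∑ l ∈ Finset.range (k + 1), (Nat.stirlingFirst k l : K) * h l) / (k ! : K)

theorem stirlingTransform_zero (h : ℕ → K) : stirlingTransform h 0 = h 0 := by
  simp [stirlingTransform]

theorem stirlingTransform_one (h : ℕ → K) : stirlingTransform h 1 = h 1 := by
  simp [stirlingTransform, Finset.sum_range_succ, Nat.stirlingFirst_one_right 0]

theorem sum_stirlingFirst_succ_mul (h : ℕ → K) (k : ℕ) :
    ∑ l ∈ Finset.range (k + 2), (Nat.stirlingFirst (k + 1) l : K) * h l =
      k * ∑ l ∈ Finset.range (k + 1), (Nat.stirlingFirst k l : K) * h l +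
        ∑ l ∈ Finset.range (k + 1), (Nat.stirlingFirst k l : K) * h (l + 1) := by
  have shift : (k : K) * ∑ l ∈ Finset.range (k + 1), (Nat.stirlingFirst k l : K) * h l =
      k * ∑ l ∈ Finset.range (k + 1), (Nat.stirlingFirst k (l + 1) : K) * h (l + 1) := by
    rw [Finset.sum_range_succ', Finset.sum_range_succ _ k,
      Nat.stirlingFirst_eq_zero_of_lt k.lt_succ_self]
    cases k <;> simp
  rw [Finset.sum_range_succ', Nat.stirlingFirst_succ_zero, Nat.cast_zero, zero_mul, add_zero,
    shift, Finset.mul_sum, ← Finset.sum_add_distrib]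
  refine Finset.sum_congr rfl fun l _ => ?_
  rw [Nat.stirlingFirst_succ_succ]
  push_cast
  ring

theorem constantCoeff_negLogOneSub : constantCoeff (negLogOneSub K) = 0 := by
  simp [negLogOneSub, ← coeff_zero_eq_constantCoeff_apply]

theorem hasSubst_negLogOneSub : HasSubst (negLogOneSub K) :=
  HasSubst.of_constantCoeff_zero' constantCoeff_negLogOneSub

variable [CharZero K]

theorem multichoose_eq_prod_div_factorial (y : K) (k : ℕ) :
    Ring.multichoose y k = (∏ i ∈ Finset.range k, (y + (i : K))) / (k ! : K) := by
  have eval_ascPochhammer : (ascPochhammer K k).eval y = ∏ i ∈ Finset.range k, (y + (i : K)) := by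
    induction k with
    | zero => simp
    | succ k ih => rw [ascPochhammer_succ_eval, ih, Finset.prod_range_succ]
  rw [eq_div_iff (Nat.cast_ne_zero.2 k.factorial_ne_zero), mul_comm, ← nsmul_eq_mul,
    Ring.factorial_nsmul_multichoose_eq_ascPochhammer, Polynomial.ascPochhammer_smeval_eq_eval,
    eval_ascPochhammer]

theorem multichoose_succ (y : K) (k : ℕ) :
    Ring.multichoose y (k + 1) = Ring.multichoose y k * ((y + k) / (k + 1)) := by
  simp only [multichoose_eq_prod_div_factorial, Finset.prod_range_succ, Nat.factorial_succ]
  push_cast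
  field_simp

theorem multichoose_succ_eq_div_mul (y : K) (k : ℕ) :
    Ring.multichoose y (k + 1) = y / (k + 1) * Ring.multichoose (y + 1) k := by
  simp only [multichoose_eq_prod_div_factorial, Finset.prod_range_succ', Nat.factorial_succ,
    Nat.cast_add, Nat.cast_one, Nat.cast_mul, Nat.cast_zero, add_zero, ← add_assoc,
    add_right_comm _ _ (1 : K)]
  field_simp

theorem stirlingTransform_pow (y : K) (k : ℕ) :
    stirlingTransform (fun l => y ^ l) k = Ring.multichoose y k := by
  rw [stirlingTransform, sum_stirlingFirst_mul_pow, multichoose_eq_prod_div_factorial]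

theorem sum_Icc_one_stirlingFirst_mul (h : ℕ → K) (k : ℕ) :
    ∑ l ∈ Finset.Icc 1 (k + 1), (Nat.stirlingFirst (k + 1) l : K) * h l =
      ((k + 1)! : K) * stirlingTransform h (k + 1) := by
  rw [stirlingTransform, mul_div_cancel₀ _ (Nat.cast_ne_zero.2 (k + 1).factorial_ne_zero),
    Finset.range_eq_Ico, Finset.sum_eq_sum_Ico_succ_bot (by lia), Nat.stirlingFirst_succ_zero,
    Nat.cast_zero, zero_mul, zero_add]
  rfl

theorem stirlingTransform_bernoulli_mul (h : ℕ → K) (k : ℕ) :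
    stirlingTransform (fun l => (bernoulli l : K) * h l) (k + 1) =
      stirlingTransform (fun l => (bernoulli' l : K) * h l) (k + 1) - h 1 / (k + 1) := by
  have bernoulli_eq (l : ℕ) :
      (bernoulli l : K) * h l = bernoulli' l * h l - if l = 1 then h 1 else 0 := by
    split_ifs with hl
    · subst hl
      rw [bernoulli_one, bernoulli'_one]
      push_cast
      ring
    · rw [bernoulli_eq_bernoulli'_of_ne_one hl, sub_zero]
  have hk : (k ! : K) ≠ 0 := Nat.cast_ne_zero.2 k.factorial_ne_zero
  simp only [stirlingTransform, bernoulli_eq, mul_sub, mul_ite, mul_zero, Finset.sum_sub_distrib,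
    Finset.sum_ite_eq', sub_div]
  rw [if_pos (by simp), Nat.stirlingFirst_one_right, Nat.factorial_succ]
  push_cast
  field_simp

theorem one_sub_X_mul_derivative_negLogOneSub :
    (1 - X) * derivative K (negLogOneSub K) = 1 := by
  ext k
  rw [sub_mul, one_mul, map_sub, coeff_derivative, coeff_one]
  cases k with
  | zero => simp [negLogOneSub]
  | succ k =>
    have h : (k : K) + 1 + 1 ≠ 0 := by exact_mod_cast (k + 1).succ_ne_zero
    simp [coeff_succ_X_mul, coeff_derivative, negLogOneSub, Nat.cast_add_one_ne_zero, h]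

theorem one_sub_X_mul_derivative_negLogOneSub_pow (l : ℕ) :
    (1 - X) * derivative K (negLogOneSub K ^ (l + 1)) = ((l : K) + 1) • negLogOneSub K ^ l := by
  rw [Derivation.leibniz_pow, Nat.add_sub_cancel, mul_smul_comm, smul_eq_mul, mul_left_comm,
    one_sub_X_mul_derivative_negLogOneSub, mul_one, ← Nat.cast_smul_eq_nsmul K, Nat.cast_add_one]

theorem succ_mul_coeff_negLogOneSub_pow (k l : ℕ) :
    ((k : K) + 1) * coeff (k + 1) (negLogOneSub K ^ (l + 1)) =
      k * coeff k (negLogOneSub K ^ (l + 1)) + (l + 1) * coeff k (negLogOneSub K ^ l) := by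
  have h := congrArg (coeff k) (one_sub_X_mul_derivative_negLogOneSub_pow (K := K) l)
  rw [sub_mul, one_mul, map_sub, coeff_derivative, coeff_smul, smul_eq_mul] at h
  cases k with
  | zero => simpa [mul_comm] using h
  | succ k =>
    rw [coeff_succ_X_mul, coeff_derivative] at h
    push_cast at h ⊢
    linear_combination h

theorem coeff_negLogOneSub_pow (k l : ℕ) :
    coeff k (negLogOneSub K ^ l) = (l ! : K) * Nat.stirlingFirst k l / (k ! : K) := by
  induction k generalizing l with
  | zero => cases l <;> simp [constantCoeff_negLogOneSub]
  | succ k ih =>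
    cases l with
    | zero => simp [coeff_one]
    | succ l =>
      apply mul_left_cancel₀ (Nat.cast_add_one_ne_zero k : (k : K) + 1 ≠ 0)
      rw [succ_mul_coeff_negLogOneSub_pow, ih, ih, Nat.stirlingFirst_succ_succ,
        Nat.factorial_succ k, Nat.factorial_succ l]
      push_cast
      field_simp

theorem coeff_subst_negLogOneSub (f : K⟦X⟧) (k : ℕ) :
    coeff k (f.subst (negLogOneSub K)) =
      stirlingTransform (fun l => (l ! : K) * coeff l f) k := by
  rw [coeff_subst' hasSubst_negLogOneSub, finsum_eq_sum_of_support_subset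
    (s := Finset.range (k + 1)), stirlingTransform, Finset.sum_div]
  · refine Finset.sum_congr rfl fun l _ => ?_
    rw [coeff_negLogOneSub_pow, smul_eq_mul]
    ring
  · refine Function.support_subset_iff'.2 fun l hl => ?_
    have hkl : k < l := by simpa using hl
    rw [coeff_negLogOneSub_pow, Nat.stirlingFirst_eq_zero_of_lt hkl, Nat.cast_zero, mul_zero,
      zero_div, smul_zero]

theorem stirlingTransform_succ (h : ℕ → K) (k : ℕ) :
    ((k : K) + 1) * stirlingTransform h (k + 1) =
      k * stirlingTransform h k + stirlingTransform (fun l => h (l + 1)) k := by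
  rw [stirlingTransform, sum_stirlingFirst_succ_mul, Nat.factorial_succ, stirlingTransform,
    stirlingTransform]
  push_cast
  field_simp

/-- The power series `(1 - e ^ (-X)) / X`. -/
def oneSubExpNegDiv (K : Type*) [Field K] : K⟦X⟧ :=
  PowerSeries.mk fun l => (-1) ^ l / ((l + 1)! : K)

theorem X_mul_oneSubExpNegDiv :
    X * oneSubExpNegDiv K = 1 - evalNegHom (PowerSeries.exp K) := by
  ext k
  cases k with
  | zero =>
    rw [coeff_zero_X_mul, map_sub, evalNegHom, coeff_rescale]
    simp
  | succ k =>
    simp [coeff_succ_X_mul, evalNegHom, oneSubExpNegDiv, coeff_one, coeff_exp, coeff_rescale,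
      pow_succ]
    ring

theorem bernoulli'PowerSeries_mul_oneSubExpNegDiv :
    bernoulli'PowerSeries K * oneSubExpNegDiv K = 1 := by
  apply mul_left_cancel₀ (X_ne_zero (R := K))
  linear_combination evalNegHom (PowerSeries.exp K) * bernoulli'PowerSeries_mul_exp_sub_one K +
    bernoulli'PowerSeries K * X_mul_oneSubExpNegDiv (K := K) +
    (X - bernoulli'PowerSeries K) * exp_mul_exp_neg_eq_one (A := K)

/-- The expansion in powers of `X` of `v / (1 - e ^ (-v))` at `v = -s log (1 - X)`. -/
noncomputable def toddLogSeries (s : K) : K⟦X⟧ :=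
  (rescale s (bernoulli'PowerSeries K)).subst (negLogOneSub K)

/-- The expansion in powers of `X` of `(1 - e ^ (-v)) / v` at `v = -s log (1 - X)`. -/
noncomputable def invToddLogSeries (s : K) : K⟦X⟧ :=
  (rescale s (oneSubExpNegDiv K)).subst (negLogOneSub K)

theorem toddLogSeries_mul_invToddLogSeries (s : K) :
    toddLogSeries s * invToddLogSeries s = 1 := by
  rw [toddLogSeries, invToddLogSeries, ← subst_mul hasSubst_negLogOneSub, ← map_mul,
    bernoulli'PowerSeries_mul_oneSubExpNegDiv, map_one,
    ← coe_substAlgHom hasSubst_negLogOneSub, map_one]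

theorem coeff_toddLogSeries (s : K) (k : ℕ) :
    coeff k (toddLogSeries s) = stirlingTransform (fun l => (bernoulli' l : K) * s ^ l) k := by
  rw [toddLogSeries, coeff_subst_negLogOneSub]
  congr 1
  ext l
  have hl : (l ! : K) ≠ 0 := by exact_mod_cast l.factorial_ne_zero
  simp only [coeff_rescale, bernoulli'PowerSeries, coeff_mk, map_div₀, map_natCast,
    eq_ratCast]
  field_simp

theorem coeff_invToddLogSeries (s : K) (k : ℕ) :
    coeff k (invToddLogSeries s) =
      stirlingTransform (fun l => (-s) ^ l / ((l : K) + 1)) k := by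
  rw [invToddLogSeries, coeff_subst_negLogOneSub]
  congr 1
  ext l
  have hl : (l ! : K) ≠ 0 := by exact_mod_cast l.factorial_ne_zero
  rw [coeff_rescale, oneSubExpNegDiv, coeff_mk, Nat.factorial_succ, neg_pow s]
  push_cast
  field_simp

end FormalPowerSeries

section ReciprocalSigns

open PowerSeries

variable {R : Type*} [CommRing R]

theorem sum_coeff_mul_coeff_eq_zero_of_mul_eq_one {f g : R⟦X⟧} (h : f * g = 1) (k : ℕ) :
    ∑ j ∈ Finset.range (k + 2), coeff j f * coeff (k + 1 - j) g = 0 := by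
  have hk := congrArg (coeff (k + 1)) h
  rwa [coeff_mul, coeff_one, if_neg k.succ_ne_zero,
    Finset.Nat.sum_antidiagonal_eq_sum_range_succ_mk] at hk

theorem coeff_zero_eq_one_of_mul_eq_one {f g : R⟦X⟧} (h : f * g = 1) (hg : coeff 0 g = 1) :
    coeff 0 f = 1 := by
  have h₀ := congrArg (coeff 0) h
  rwa [coeff_mul, Finset.Nat.antidiagonal_zero, Finset.sum_singleton, hg, mul_one,
    coeff_zero_one] at h₀

theorem coeff_nonneg_of_mul_eq_one_of_coeff_nonpos [PartialOrder R] [IsOrderedRing R]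
    {f g : R⟦X⟧} (h : f * g = 1) (hg₀ : coeff 0 g = 1) (hg : ∀ k, coeff (k + 1) g ≤ 0) (k : ℕ) :
    0 ≤ coeff k f := by
  induction k using Nat.strong_induction_on with
  | _ k ih =>
    cases k with
    | zero => simp [coeff_zero_eq_one_of_mul_eq_one h hg₀]
    | succ k =>
      have renewal := sum_coeff_mul_coeff_eq_zero_of_mul_eq_one h k
      rw [Finset.sum_range_succ, Nat.sub_self, hg₀, mul_one] at renewal
      rw [eq_neg_of_add_eq_zero_right renewal, neg_nonneg]
      refine Finset.sum_nonpos fun j hj => ?_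
      have hj := Finset.mem_range.1 hj
      rw [Nat.succ_sub (Nat.le_of_lt_succ hj)]
      exact mul_nonpos_of_nonneg_of_nonpos (ih j hj) (hg _)

variable [LinearOrder R] [IsStrictOrderedRing R]

theorem mul_succ_le_succ_mul_of_sq_le {r : ℕ → R} (hpos : ∀ k, 0 < r k)
    (hconv : ∀ k, r (k + 1) ^ 2 ≤ r k * r (k + 2)) (j d : ℕ) :
    r (j + d) * r (j + 1) ≤ r (j + d + 1) * r j := by
  induction d with
  | zero => exact (mul_comm _ _).le
  | succ d ih =>
    refine le_of_mul_le_mul_left ?_ (hpos (j + d))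
    calc r (j + d) * (r (j + d + 1) * r (j + 1))
        = r (j + d + 1) * (r (j + d) * r (j + 1)) := mul_left_comm _ _ _
      _ ≤ r (j + d + 1) * (r (j + d + 1) * r j) := mul_le_mul_of_nonneg_left ih (hpos _).le
      _ = r (j + d + 1) ^ 2 * r j := by ring
      _ ≤ r (j + d) * r (j + d + 2) * r j := mul_le_mul_of_nonneg_right (hconv _) (hpos j).le
      _ = r (j + d) * (r (j + d + 2) * r j) := mul_assoc _ _ _

theorem coeff_mul_coeff_eq_sum_of_mul_eq_one {f g : R⟦X⟧} (h : f * g = 1) (hg₀ : coeff 0 g = 1)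
    (k : ℕ) :
    coeff (k + 2) f * coeff (k + 1) g = ∑ j ∈ Finset.range (k + 2), coeff j f *
      (coeff (k + 2) g * coeff (k + 1 - j) g - coeff (k + 1) g * coeff (k + 2 - j) g) := by
  have h₁ := sum_coeff_mul_coeff_eq_zero_of_mul_eq_one h k
  have h₂ := sum_coeff_mul_coeff_eq_zero_of_mul_eq_one h (k + 1)
  rw [Finset.sum_range_succ, Nat.sub_self, hg₀, mul_one] at h₂
  simp only [mul_sub, Finset.sum_sub_distrib, mul_left_comm _ (coeff _ g), ← Finset.mul_sum]
  linear_combination coeff (k + 1) g * h₂ - coeff (k + 2) g * h₁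

/-- **Kaluza's theorem** -/
theorem coeff_nonpos_of_mul_eq_one_of_sq_le {f g : R⟦X⟧} (h : f * g = 1) (hg₀ : coeff 0 g = 1)
    (hpos : ∀ k, 0 < coeff k g) (hconv : ∀ k, coeff (k + 1) g ^ 2 ≤ coeff k g * coeff (k + 2) g)
    (k : ℕ) : coeff (k + 1) f ≤ 0 := by
  have hf₀ := coeff_zero_eq_one_of_mul_eq_one h hg₀
  induction k using Nat.strong_induction_on with
  | _ k ih =>
    cases k with
    | zero =>
      have h₁ : coeff 1 g + coeff 1 f = 0 := by
        simpa [Finset.sum_range_succ, hf₀, hg₀, -coeff_zero_eq_constantCoeff] using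
          sum_coeff_mul_coeff_eq_zero_of_mul_eq_one h 0
      linarith [hpos 1]
    | succ k =>
      refine nonpos_of_mul_nonpos_left ?_ (hpos (k + 1))
      rw [coeff_mul_coeff_eq_sum_of_mul_eq_one h hg₀]
      refine Finset.sum_nonpos fun j hj => ?_
      have hj := Finset.mem_range.1 hj
      cases j with
      | zero => simp [mul_comm]
      | succ j =>
        refine mul_nonpos_of_nonpos_of_nonneg (ih j (by omega)) (sub_nonneg.2 ?_)
        have ratio := mul_succ_le_succ_mul_of_sq_le hpos hconv (k - j) (j + 1)
        rwa [show k - j + (j + 1) = k + 1 by omega, show k - j + 1 = k + 2 - (j + 1) by omega,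
          show k - j = k + 1 - (j + 1) by omega] at ratio

end ReciprocalSigns

section MultichooseBounds

variable {K : Type*} [Field K] [LinearOrder K] [IsStrictOrderedRing K] {y : K}

theorem multichoose_nonneg (hy : 0 ≤ y) (k : ℕ) : 0 ≤ Ring.multichoose y k :=
  multichoose_eq_prod_div_factorial y k ▸ div_nonneg
    (Finset.prod_nonneg fun i _ => add_nonneg hy i.cast_nonneg) (k !).cast_nonneg

theorem multichoose_pos (hy : 0 < y) (k : ℕ) : 0 < Ring.multichoose y k :=
  multichoose_eq_prod_div_factorial y k ▸ div_pos
    (Finset.prod_pos fun i _ => add_pos_of_pos_of_nonneg hy i.cast_nonneg)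
    (Nat.cast_pos.2 k.factorial_pos)

theorem multichoose_succ_nonpos (hy : -1 ≤ y) (hy' : y ≤ 0) (k : ℕ) :
    Ring.multichoose y (k + 1) ≤ 0 := by
  rw [multichoose_succ_eq_div_mul]
  exact mul_nonpos_of_nonpos_of_nonneg (div_nonpos_of_nonpos_of_nonneg hy' (by positivity))
    (multichoose_nonneg (by linarith) k)

theorem abs_multichoose_le_one (hy : |y| ≤ 1) (k : ℕ) : |Ring.multichoose y k| ≤ 1 := by
  induction k with
  | zero => simp
  | succ k ih =>
    rw [multichoose_succ, abs_mul, abs_div, abs_of_pos (by positivity : (0 : K) < k + 1)]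
    refine mul_le_one₀ ih (by positivity) ((div_le_one (by positivity)).2 ?_)
    calc |y + k| ≤ |y| + |(k : K)| := abs_add_le _ _
      _ ≤ k + 1 := by rw [Nat.abs_cast]; linarith

theorem multichoose_succ_sq_le (hy : 0 ≤ y) (hy' : y ≤ 1) (k : ℕ) :
    Ring.multichoose y (k + 1) ^ 2 ≤ Ring.multichoose y k * Ring.multichoose y (k + 2) := by
  have ratio_le : (y + k) / (k + 1) ≤ (y + (k + 1 : ℕ)) / ((k + 1 : ℕ) + 1) := by
    push_cast
    rw [div_le_div_iff₀ (by positivity) (by positivity)]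
    linarith
  rw [multichoose_succ y (k + 1), multichoose_succ y k]
  calc (Ring.multichoose y k * ((y + k) / (k + 1))) ^ 2
      = Ring.multichoose y k ^ 2 * ((y + k) / (k + 1)) * ((y + k) / (k + 1)) := by ring
    _ ≤ Ring.multichoose y k ^ 2 * ((y + k) / (k + 1)) *
          ((y + (k + 1 : ℕ)) / ((k + 1 : ℕ) + 1)) := by gcongr
    _ = _ := by ring

end MultichooseBounds

section ToddLogSeries

open MeasureTheory PowerSeries

theorem sq_integral_le_integral_mul_integral {α : Type*} [MeasurableSpace α] {μ : Measure α}
    {f₀ f₁ f₂ : α → ℝ} (hf₀ : Integrable f₀ μ) (hf₁ : Integrable f₁ μ) (hf₂ : Integrable f₂ μ)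
    (h₀ : 0 ≤ᵐ[μ] f₀) (h₂ : 0 ≤ᵐ[μ] f₂) (h : ∀ᵐ x ∂μ, f₁ x ^ 2 ≤ f₀ x * f₂ x) :
    (∫ x, f₁ x ∂μ) ^ 2 ≤ (∫ x, f₀ x ∂μ) * ∫ x, f₂ x ∂μ := by
  have quadratic_nonneg (c : ℝ) :
      0 ≤ (∫ x, f₀ x ∂μ) * (c * c) + 2 * (∫ x, f₁ x ∂μ) * c + ∫ x, f₂ x ∂μ := by
    calc 0 ≤ ∫ x, ((c * c) * f₀ x + (2 * c) * f₁ x + f₂ x) ∂μ := by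
          refine integral_nonneg_of_ae ?_
          filter_upwards [h₀, h₂, h] with x (hx₀ : 0 ≤ f₀ x) (hx₂ : 0 ≤ f₂ x) hx
          rcases hx₀.eq_or_lt with hx₀ | hx₀
          · rw [← hx₀, zero_mul] at hx
            simpa [← hx₀, pow_eq_zero_iff two_ne_zero |>.1 (hx.antisymm (sq_nonneg _))] using hx₂
          · refine nonneg_of_mul_nonneg_right (?_ : 0 ≤ f₀ x * _) hx₀
            linarith [sq_nonneg (c * f₀ x + f₁ x)]
      _ = _ := by
          rw [integral_add ((hf₀.const_mul _).fun_add (hf₁.const_mul _)) hf₂,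
            integral_add (hf₀.const_mul _) (hf₁.const_mul _), integral_const_mul,
            integral_const_mul]
          ring
  have := discrim_le_zero quadratic_nonneg
  rw [discrim] at this
  linarith

theorem continuous_multichoose (k : ℕ) : Continuous fun y : ℝ => Ring.multichoose y k := by
  simp only [multichoose_eq_prod_div_factorial]
  fun_prop

theorem coeff_invToddLogSeries_eq_integral (s : ℝ) (k : ℕ) :
    coeff k (invToddLogSeries s) = ∫ v in (0 : ℝ)..1, Ring.multichoose (-(s * v)) k := by
  simp only [← stirlingTransform_pow, coeff_invToddLogSeries, stirlingTransform, ← neg_mul,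
    mul_pow]
  rw [intervalIntegral.integral_div, intervalIntegral.integral_finsetSum fun l _ =>
    (by fun_prop : Continuous _).intervalIntegrable _ _]
  simp only [intervalIntegral.integral_const_mul, integral_pow, one_pow, ne_eq,
    Nat.succ_ne_zero, not_false_eq_true, zero_pow, sub_zero, mul_one_div]

/-- The partial sums of the coefficients of `invToddLogSeries s`, see
`one_sub_X_mul_invToddLogSums`. -/
noncomputable def invToddLogSums (s : ℝ) : ℝ⟦X⟧ :=
  PowerSeries.mk fun k => ∫ v in (0 : ℝ)..1, Ring.multichoose (-(s * v) + 1) k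

theorem intervalIntegrable_multichoose {g : ℝ → ℝ} (hg : Continuous g) (k : ℕ) :
    IntervalIntegrable (fun v => Ring.multichoose (g v) k) volume 0 1 :=
  ((continuous_multichoose k).comp hg).intervalIntegrable _ _

theorem coeff_zero_invToddLogSeries (s : ℝ) : coeff 0 (invToddLogSeries s) = 1 := by
  simp [coeff_invToddLogSeries, stirlingTransform_zero, -coeff_zero_eq_constantCoeff]

theorem coeff_zero_invToddLogSums (s : ℝ) : coeff 0 (invToddLogSums s) = 1 := by
  simp [invToddLogSums, -coeff_zero_eq_constantCoeff]

theorem one_sub_X_mul_invToddLogSums (s : ℝ) :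
    (1 - X) * invToddLogSums s = invToddLogSeries s := by
  ext k
  rw [sub_mul, one_mul, map_sub]
  cases k with
  | zero => rw [coeff_zero_X_mul, sub_zero, coeff_zero_invToddLogSums, coeff_zero_invToddLogSeries]
  | succ k =>
    rw [coeff_succ_X_mul, invToddLogSums, coeff_mk, coeff_mk, coeff_invToddLogSeries_eq_integral,
      ← intervalIntegral.integral_sub (intervalIntegrable_multichoose (by fun_prop) _)
        (intervalIntegrable_multichoose (by fun_prop) _)]
    simp only [Ring.multichoose_succ_succ, add_sub_cancel_right]

theorem coeff_invToddLogSums_pos {s : ℝ} (hs₁ : s ≤ 1) (k : ℕ) :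
    0 < coeff k (invToddLogSums s) := by
  rw [invToddLogSums, coeff_mk]
  refine intervalIntegral.intervalIntegral_pos_of_pos_on
    (intervalIntegrable_multichoose (by fun_prop) k) (fun v hv => ?_) zero_lt_one
  have : s * v < 1 := mul_lt_one_of_nonneg_of_lt_one_right hs₁ hv.1.le hv.2
  exact multichoose_pos (by linarith) k

section Sign

variable {s : ℝ} (hs₀ : 0 ≤ s) (hs₁ : s ≤ 1)
include hs₀ hs₁

theorem neg_mul_mem_Icc {v : ℝ} (hv : v ∈ Set.Icc (0 : ℝ) 1) :
    -(s * v) ∈ Set.Icc (-1 : ℝ) 0 :=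
  ⟨neg_le_neg (mul_le_one₀ hs₁ hv.1 hv.2), neg_nonpos.2 (mul_nonneg hs₀ hv.1)⟩

theorem coeff_succ_invToddLogSeries_nonpos (k : ℕ) : coeff (k + 1) (invToddLogSeries s) ≤ 0 := by
  rw [coeff_invToddLogSeries_eq_integral, intervalIntegral.integral_of_le zero_le_one]
  refine setIntegral_nonpos measurableSet_Ioc fun v hv => ?_
  have hsv := neg_mul_mem_Icc hs₀ hs₁ (Set.Ioc_subset_Icc_self hv)
  exact multichoose_succ_nonpos hsv.1 hsv.2 k

theorem coeff_toddLogSeries_nonneg (k : ℕ) : 0 ≤ coeff k (toddLogSeries s) :=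
  coeff_nonneg_of_mul_eq_one_of_coeff_nonpos (toddLogSeries_mul_invToddLogSeries s)
    (coeff_zero_invToddLogSeries s) (coeff_succ_invToddLogSeries_nonpos hs₀ hs₁) k

theorem coeff_succ_invToddLogSums_sq_le (k : ℕ) :
    coeff (k + 1) (invToddLogSums s) ^ 2 ≤
      coeff k (invToddLogSums s) * coeff (k + 2) (invToddLogSums s) := by
  have hmem : ∀ᵐ v ∂volume.restrict (Set.Ioc (0 : ℝ) 1), -(s * v) ∈ Set.Icc (-1 : ℝ) 0 :=
    ae_restrict_of_forall_mem measurableSet_Ioc fun v hv =>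
      neg_mul_mem_Icc hs₀ hs₁ (Set.Ioc_subset_Icc_self hv)
  have hint (j : ℕ) :=
    (intervalIntegrable_multichoose (by fun_prop : Continuous fun v => -(s * v) + 1) j).1
  simp only [invToddLogSums, coeff_mk, intervalIntegral.integral_of_le zero_le_one]
  refine sq_integral_le_integral_mul_integral (hint k) (hint (k + 1)) (hint (k + 2)) ?_ ?_ ?_ <;>
    filter_upwards [hmem] with v hv
  · exact multichoose_nonneg (by linarith [hv.1]) k
  · exact multichoose_nonneg (by linarith [hv.1]) (k + 2)
  · exact multichoose_succ_sq_le (by linarith [hv.1]) (by linarith [hv.2]) k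

theorem antitone_coeff_toddLogSeries : Antitone fun k => coeff k (toddLogSeries s) := by
  have h : ((1 - X) * toddLogSeries s) * invToddLogSums s = 1 := by
    rw [mul_right_comm, one_sub_X_mul_invToddLogSums, mul_comm,
      toddLogSeries_mul_invToddLogSeries]
  refine antitone_nat_of_succ_le fun k => ?_
  have := coeff_nonpos_of_mul_eq_one_of_sq_le h (coeff_zero_invToddLogSums s)
    (coeff_invToddLogSums_pos hs₁) (coeff_succ_invToddLogSums_sq_le hs₀ hs₁) k
  rwa [sub_mul, one_mul, map_sub, coeff_succ_X_mul, sub_nonpos] at this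

theorem abs_coeff_invToddLogSeries_le_one (k : ℕ) : |coeff k (invToddLogSeries s)| ≤ 1 := by
  rw [coeff_invToddLogSeries_eq_integral, ← Real.norm_eq_abs]
  refine (intervalIntegral.norm_integral_le_of_norm_le_const (C := 1) fun v hv => ?_).trans
    (by simp)
  rw [Set.uIoc_of_le zero_le_one] at hv
  have hsv := neg_mul_mem_Icc hs₀ hs₁ (Set.Ioc_subset_Icc_self hv)
  exact abs_multichoose_le_one (abs_le.2 ⟨hsv.1, hsv.2.trans zero_le_one⟩) k

end Sign

theorem hasSum_multichoose_mul_pow (y : ℝ) {x : ℝ} (hx : |x| < 1) :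
    HasSum (fun k => Ring.multichoose y k * x ^ k) ((1 - x) ^ (-y)) := by
  have h := (Real.one_div_one_sub_rpow_hasFPowerSeriesOnBall_zero y).hasSum_sub (y := x)
    (by simpa [← ofReal_norm, ENNReal.ofReal_lt_one] using hx)
  simpa [Ring.multichoose_eq, Real.rpow_neg (sub_pos.2 (abs_lt.1 hx).2).le, mul_comm] using h

theorem tsum_mul_tsum_eq_tsum_coeff_mul_mul_pow {f g : ℝ⟦X⟧} {x : ℝ}
    (hf : Summable fun k => ‖coeff k f * x ^ k‖) (hg : Summable fun k => ‖coeff k g * x ^ k‖) :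
    (∑' k, coeff k f * x ^ k) * ∑' k, coeff k g * x ^ k = ∑' k, coeff k (f * g) * x ^ k := by
  rw [tsum_mul_tsum_eq_tsum_sum_antidiagonal_of_summable_norm hf hg]
  refine tsum_congr fun k => ?_
  rw [coeff_mul, Finset.sum_mul]
  refine Finset.sum_congr rfl fun p hp => ?_
  rw [← Finset.HasAntidiagonal.mem_antidiagonal.1 hp, pow_add]
  ring

theorem hasSum_coeff_mul_pow_inv_of_mul_eq_one {f g : ℝ⟦X⟧} (hfg : f * g = 1) {x S : ℝ}
    (hf : Summable fun k => ‖coeff k f * x ^ k‖) (hg : Summable fun k => ‖coeff k g * x ^ k‖)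
    (hS : HasSum (fun k => coeff k g * x ^ k) S) :
    HasSum (fun k => coeff k f * x ^ k) S⁻¹ := by
  have h := tsum_mul_tsum_eq_tsum_coeff_mul_mul_pow hf hg
  simp only [hfg, coeff_one, ite_mul, one_mul, zero_mul, tsum_ite_eq, pow_zero, hS.tsum_eq] at h
  exact eq_inv_of_mul_eq_one_left h ▸ hf.of_norm.hasSum

theorem summable_norm_mul_pow_of_abs_le_one {c : ℕ → ℝ} (hc : ∀ k, |c k| ≤ 1) {x : ℝ}
    (hx : |x| < 1) : Summable fun k => ‖c k * x ^ k‖ := by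
  refine (summable_geometric_of_lt_one (abs_nonneg x) hx).of_nonneg_of_le
    (fun k => norm_nonneg _) fun k => ?_
  rw [norm_mul, norm_pow, Real.norm_eq_abs, Real.norm_eq_abs]
  exact mul_le_of_le_one_left (by positivity) (hc k)

theorem integral_exp_neg_mul {c : ℝ} (hc : c ≠ 0) :
    ∫ v in (0 : ℝ)..1, Real.exp (-c * v) = (1 - Real.exp (-c)) / c := by
  rw [intervalIntegral.integral_comp_mul_left (fun y => Real.exp y) (neg_ne_zero.2 hc),
    integral_exp, mul_zero, mul_one, Real.exp_zero, smul_eq_mul]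
  field_simp
  ring

theorem one_sub_exp_neg_mem_Ioo {t : ℝ} (ht : 0 < t) : 1 - Real.exp (-t) ∈ Set.Ioo (0 : ℝ) 1 :=
  ⟨sub_pos.2 (Real.exp_lt_one_iff.2 (neg_lt_zero.2 ht)), sub_lt_self _ (Real.exp_pos _)⟩

section Evaluation

variable {s : ℝ} (hs : s ∈ Set.Ioc (0 : ℝ) 1) {t : ℝ} (ht : 0 < t)
include hs

theorem abs_coeff_toddLogSeries_le_one (k : ℕ) : |coeff k (toddLogSeries s)| ≤ 1 := by
  rw [abs_of_nonneg (coeff_toddLogSeries_nonneg hs.1.le hs.2 k)]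
  refine (antitone_coeff_toddLogSeries hs.1.le hs.2 k.zero_le).trans_eq ?_
  exact coeff_zero_eq_one_of_mul_eq_one (toddLogSeries_mul_invToddLogSeries s)
    (coeff_zero_invToddLogSeries s)

include ht

theorem hasSum_coeff_invToddLogSeries_mul_pow :
    HasSum (fun k => coeff k (invToddLogSeries s) * (1 - Real.exp (-t)) ^ k)
      ((1 - Real.exp (-(s * t))) / (s * t)) := by
  obtain ⟨hx₀, hx₁⟩ := one_sub_exp_neg_mem_Ioo ht
  set x := 1 - Real.exp (-t) with hx
  have rpow_eq (v : ℝ) : (1 - x) ^ (-(-(s * v))) = Real.exp (-(s * t) * v) := by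
    rw [hx, sub_sub_cancel, ← Real.exp_mul]
    ring_nf
  rw [← integral_exp_neg_mul (mul_pos hs.1 ht).ne']
  simp only [coeff_invToddLogSeries_eq_integral, ← intervalIntegral.integral_mul_const,
    ← rpow_eq]
  refine intervalIntegral.hasSum_integral_of_dominated_convergence (fun k _ => x ^ k)
    (fun k => ?_) (fun k => .of_forall fun v hv => ?_)
    (.of_forall fun v _ => summable_geometric_of_lt_one hx₀.le hx₁) (by simp)
    (.of_forall fun v _ => hasSum_multichoose_mul_pow _ (by rwa [abs_of_pos hx₀]))
  · exact (((continuous_multichoose k).comp (by fun_prop)).mul_const _).aestronglyMeasurable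
  · rw [Set.uIoc_of_le zero_le_one] at hv
    have hsv := neg_mul_mem_Icc hs.1.le hs.2 (Set.Ioc_subset_Icc_self hv)
    rw [norm_mul, norm_pow, Real.norm_of_nonneg hx₀.le, Real.norm_eq_abs]
    exact mul_le_of_le_one_left (by positivity)
      (abs_multichoose_le_one (abs_le.2 ⟨hsv.1, hsv.2.trans zero_le_one⟩) k)

theorem hasSum_coeff_toddLogSeries_mul_pow :
    HasSum (fun k => coeff k (toddLogSeries s) * (1 - Real.exp (-t)) ^ k)
      (s * t / (1 - Real.exp (-(s * t)))) := by
  have hx : |1 - Real.exp (-t)| < 1 := by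
    obtain ⟨hx₀, hx₁⟩ := one_sub_exp_neg_mem_Ioo ht
    rwa [abs_of_pos hx₀]
  simpa only [inv_div] using hasSum_coeff_mul_pow_inv_of_mul_eq_one
    (toddLogSeries_mul_invToddLogSeries s)
    (summable_norm_mul_pow_of_abs_le_one (abs_coeff_toddLogSeries_le_one hs) hx)
    (summable_norm_mul_pow_of_abs_le_one (abs_coeff_invToddLogSeries_le_one hs.1.le hs.2) hx)
    (hasSum_coeff_invToddLogSeries_mul_pow hs ht)

end Evaluation

end ToddLogSeries

section Beta

open MeasureTheory ProbabilityTheory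

theorem add_mul_beta_add_one {a b : ℝ} (ha : 0 < a) (hb : 0 < b) :
    (a + b) * beta a (b + 1) = b * beta a b := by
  have hab : a + b ≠ 0 := by positivity
  have := (Real.Gamma_pos_of_pos (add_pos ha hb)).ne'
  rw [beta, beta, Real.Gamma_add_one hb.ne', ← add_assoc, Real.Gamma_add_one hab]
  field_simp

theorem beta_add_one_left_add_beta_add_one_right {a b : ℝ} (ha : 0 < a) (hb : 0 < b) :
    beta (a + 1) b + beta a (b + 1) = beta a b := by
  have hab : a + b ≠ 0 := by positivity
  have := (Real.Gamma_pos_of_pos (add_pos ha hb)).ne'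
  rw [beta, beta, beta, Real.Gamma_add_one ha.ne', Real.Gamma_add_one hb.ne', ← add_assoc,
    add_right_comm, Real.Gamma_add_one hab]
  field_simp

theorem beta_one_right {a : ℝ} (ha : 0 < a) : beta a 1 = 1 / a := by
  have := (Real.Gamma_pos_of_pos ha).ne'
  rw [beta, Real.Gamma_one, mul_one, Real.Gamma_add_one ha.ne', div_mul_cancel_right₀ this,
    one_div]

theorem beta_natCast_add_one {a : ℝ} (ha : 0 < a) (k : ℕ) :
    beta a (k + 1) = k ! / (a * ∏ i ∈ Finset.Icc 1 k, (a + i)) := by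
  induction k with
  | zero => simp [beta_one_right ha]
  | succ k ih =>
    have : 0 < ∏ i ∈ Finset.Icc 1 k, (a + i) := Finset.prod_pos fun i _ => by positivity
    have hak : a + (k + 1) ≠ 0 := by positivity
    have hrec := add_mul_beta_add_one ha (by positivity : (0 : ℝ) < k + 1)
    rw [ih] at hrec
    rw [Finset.prod_Icc_succ_top (by lia), Nat.factorial_succ]
    push_cast
    rw [← mul_right_inj' hak, hrec]
    field_simp

theorem integrableOn_exp_neg_mul_mul_one_sub_exp_neg_pow {a : ℝ} (ha : 0 < a) (k : ℕ) :
    IntegrableOn (fun t => Real.exp (-a * t) * (1 - Real.exp (-t)) ^ k) (Set.Ioi 0) := by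
  refine (integrableOn_exp_mul_Ioi (neg_lt_zero.2 ha) 0).mono'
    (by fun_prop : Continuous _).aestronglyMeasurable
    (ae_restrict_of_forall_mem measurableSet_Ioi fun t ht => ?_)
  obtain ⟨hx₀, hx₁⟩ := one_sub_exp_neg_mem_Ioo ht
  rw [Real.norm_of_nonneg (by positivity)]
  exact mul_le_of_le_one_right (by positivity) (pow_le_one₀ hx₀.le hx₁.le)

theorem integral_exp_neg_mul_mul_one_sub_exp_neg_pow {a : ℝ} (ha : 0 < a) (k : ℕ) :
    ∫ t in Set.Ioi 0, Real.exp (-a * t) * (1 - Real.exp (-t)) ^ k = beta a (k + 1) := by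
  induction k generalizing a with
  | zero => simpa [beta_one_right ha, ← one_div] using integral_exp_mul_Ioi (neg_lt_zero.2 ha) 0
  | succ k ih =>
    have split (t : ℝ) : Real.exp (-a * t) * (1 - Real.exp (-t)) ^ (k + 1) =
        Real.exp (-a * t) * (1 - Real.exp (-t)) ^ k -
          Real.exp (-(a + 1) * t) * (1 - Real.exp (-t)) ^ k := by
      rw [neg_add, add_mul, Real.exp_add, neg_one_mul]
      ring
    simp only [split]
    rw [integral_sub (integrableOn_exp_neg_mul_mul_one_sub_exp_neg_pow ha k)
      (integrableOn_exp_neg_mul_mul_one_sub_exp_neg_pow (by positivity) k), ih ha,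
      ih (by positivity), Nat.cast_succ,
      ← beta_add_one_left_add_beta_add_one_right ha (by positivity), add_sub_cancel_left]

theorem integrableOn_mul_exp_neg_mul {a : ℝ} (ha : 0 < a) :
    IntegrableOn (fun t => t * Real.exp (-a * t)) (Set.Ioi 0) := by
  simpa using integrableOn_rpow_mul_exp_neg_mul_rpow (p := 1) (s := 1) (b := a) (by norm_num)
    one_pos ha

theorem integral_mul_exp_neg_mul {a : ℝ} (ha : 0 < a) :
    ∫ t in Set.Ioi 0, t * Real.exp (-a * t) = 1 / a ^ 2 := by
  have := Real.integral_rpow_mul_exp_neg_mul_Ioi (a := 2) (r := a) two_pos ha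
  rw [Real.Gamma_two, (by norm_num : (2 : ℝ) - 1 = 1)] at this
  simpa using this

end Beta

section Tonelli

open MeasureTheory

variable {α : Type*} [MeasurableSpace α] {μ : Measure α} {f g : ℕ → α → ℝ} {F : α → ℝ}

theorem tsum_ofReal_integral_eq_lintegral (hf : ∀ k, 0 ≤ᵐ[μ] f k)
    (hf_int : ∀ k, Integrable (f k) μ) (hfF : ∀ᵐ x ∂μ, HasSum (fun k => f k x) (F x)) :
    ∑' k, ENNReal.ofReal (∫ x, f k x ∂μ) = ∫⁻ x, ENNReal.ofReal (F x) ∂μ := by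
  simp only [ofReal_integral_eq_lintegral_ofReal (hf_int _) (hf _)]
  rw [← lintegral_tsum fun k => (hf_int k).aemeasurable.ennreal_ofReal]
  refine lintegral_congr_ae ?_
  filter_upwards [hfF, ae_all_iff.2 hf] with x hx hx₀
  rw [← hx.tsum_eq, ENNReal.ofReal_tsum_of_nonneg hx₀ hx.summable]

theorem hasSum_integral_of_hasSum_integral {S : ℝ} (hf : ∀ k, 0 ≤ᵐ[μ] f k)
    (hg : ∀ m, 0 ≤ᵐ[μ] g m) (hf_int : ∀ k, Integrable (f k) μ)
    (hg_int : ∀ m, Integrable (g m) μ) (hfF : ∀ᵐ x ∂μ, HasSum (fun k => f k x) (F x))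
    (hgF : ∀ᵐ x ∂μ, HasSum (fun m => g m x) (F x)) (hS : HasSum (fun m => ∫ x, g m x ∂μ) S) :
    HasSum (fun k => ∫ x, f k x ∂μ) S := by
  have tsum_eq : ∑' k, ENNReal.ofReal (∫ x, f k x ∂μ) = ENNReal.ofReal S := by
    rw [tsum_ofReal_integral_eq_lintegral hf hf_int hfF,
      ← tsum_ofReal_integral_eq_lintegral hg hg_int hgF, ← hS.tsum_eq,
      ENNReal.ofReal_tsum_of_nonneg (fun m => integral_nonneg_of_ae (hg m)) hS.summable]
  have h := ENNReal.hasSum_toReal (tsum_eq ▸ ENNReal.ofReal_ne_top)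
  rw [← ENNReal.tsum_toReal_eq fun _ => ENNReal.ofReal_ne_top, tsum_eq,
    ENNReal.toReal_ofReal (hS.nonneg fun m => integral_nonneg_of_ae (hg m))] at h
  simpa only [ENNReal.toReal_ofReal (integral_nonneg_of_ae (hf _))] using h

end Tonelli

section Mixture

open MeasureTheory ProbabilityTheory PowerSeries

theorem hasSum_mul_exp_neg_mul {v : ℝ} (hv : 0 < v) :
    HasSum (fun m : ℕ => v * Real.exp (-(m * v))) (v / (1 - Real.exp (-v))) := by
  simpa [← mul_neg, Real.exp_nat_mul, div_eq_mul_inv] using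
    (hasSum_geometric_of_lt_one (Real.exp_pos (-v)).le
      (Real.exp_lt_one_iff.2 (neg_lt_zero.2 hv))).mul_left v

theorem summable_div_add_natCast_mul_sq {s a : ℝ} (hs : 0 < s) (ha : 0 < a) :
    Summable fun m : ℕ => s / (a + m * s) ^ 2 := by
  refine (((Real.summable_one_div_nat_add_rpow (a / s) 2).2 one_lt_two).mul_left (1 / s)).congr
    fun m => ?_
  rw [abs_of_pos (by positivity), Real.rpow_two]
  field_simp
  ring

theorem hasSum_coeff_toddLogSeries_mul_beta {s : ℝ} (hs : s ∈ Set.Ioc (0 : ℝ) 1) {a : ℝ}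
    (ha : 0 < a) :
    HasSum (fun k : ℕ => coeff k (toddLogSeries s) * beta a (k + 1))
      (∑' m : ℕ, s / (a + m * s) ^ 2) := by
  have hs₀ := hs.1
  have hams (m : ℕ) : 0 < a + m * s := by positivity
  have integral_eq (m : ℕ) :
      ∫ t in Set.Ioi 0, s * (t * Real.exp (-(a + m * s) * t)) = s / (a + m * s) ^ 2 := by
    rw [integral_const_mul, integral_mul_exp_neg_mul (hams m), mul_one_div]
  have h : HasSum (fun k : ℕ => ∫ t in Set.Ioi 0,
      coeff k (toddLogSeries s) * (Real.exp (-a * t) * (1 - Real.exp (-t)) ^ k))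
      (∑' m : ℕ, s / (a + m * s) ^ 2) := by
    refine hasSum_integral_of_hasSum_integral
      (g := fun m t => s * (t * Real.exp (-(a + m * s) * t)))
      (F := fun t => Real.exp (-a * t) * (s * t / (1 - Real.exp (-(s * t)))))
      (fun k => ?_) (fun m => ?_)
      (fun k => (integrableOn_exp_neg_mul_mul_one_sub_exp_neg_pow ha k).const_mul _)
      (fun m => (integrableOn_mul_exp_neg_mul (hams m)).const_mul s) ?_ ?_
      (by simpa only [integral_eq] using (summable_div_add_natCast_mul_sq hs₀ ha).hasSum) <;>
      refine ae_restrict_of_forall_mem measurableSet_Ioi fun t (ht : 0 < t) => ?_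
    · have hx := (one_sub_exp_neg_mem_Ioo ht).1.le
      exact mul_nonneg (coeff_toddLogSeries_nonneg hs₀.le hs.2 k) (by positivity)
    · exact mul_nonneg hs₀.le (by positivity)
    · simpa only [mul_left_comm] using
        (hasSum_coeff_toddLogSeries_mul_pow hs ht).mul_left (Real.exp (-a * t))
    · refine ((hasSum_mul_exp_neg_mul (mul_pos hs₀ ht)).mul_left (Real.exp (-a * t))).congr_fun
        fun m => ?_
      rw [neg_add, add_mul, Real.exp_add]
      ring_nf
  simpa only [integral_const_mul, integral_exp_neg_mul_mul_one_sub_exp_neg_pow ha] using h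

/-- The average over `μ` of the `k`-th coefficient of `toddLogSeries s`. For the arcsine law this
replaces the powers of `s` by the factors `(2 l - 1)‼ / (2 ^ l * l !)`, see
`meanToddLogCoeff_eq_stirlingTransform`. -/
noncomputable def meanToddLogCoeff (μ : Measure ℝ) (k : ℕ) : ℝ :=
  ∫ s, coeff k (toddLogSeries s) ∂μ

theorem continuous_coeff_toddLogSeries (k : ℕ) :
    Continuous fun s : ℝ => coeff k (toddLogSeries s) := by
  simp only [coeff_toddLogSeries, stirlingTransform]
  fun_prop

theorem integrable_of_continuousOn_of_ae_mem_Ioc {E : Type*} [NormedAddCommGroup E]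
    {μ : Measure ℝ} [IsFiniteMeasure μ] {a b : ℝ} {f : ℝ → E}
    (hf : ContinuousOn f (Set.Icc a b)) (hμ : ∀ᵐ s ∂μ, s ∈ Set.Ioc a b) : Integrable f μ := by
  rw [← Measure.restrict_eq_self_of_ae_mem hμ]
  exact hf.integrableOn_Icc.mono_set Set.Ioc_subset_Icc_self

variable {μ : Measure ℝ} (hμ : ∀ᵐ s ∂μ, s ∈ Set.Ioc (0 : ℝ) 1)
include hμ

theorem meanToddLogCoeff_nonneg (k : ℕ) : 0 ≤ meanToddLogCoeff μ k :=
  integral_nonneg_of_ae (hμ.mono fun _ hs => coeff_toddLogSeries_nonneg hs.1.le hs.2 k)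

variable [IsFiniteMeasure μ]

theorem integrable_coeff_toddLogSeries (k : ℕ) :
    Integrable (fun s => coeff k (toddLogSeries s)) μ :=
  integrable_of_continuousOn_of_ae_mem_Ioc (continuous_coeff_toddLogSeries k).continuousOn hμ

theorem antitone_meanToddLogCoeff : Antitone (meanToddLogCoeff μ) := fun j k hjk =>
  integral_mono_ae (integrable_coeff_toddLogSeries hμ k) (integrable_coeff_toddLogSeries hμ j)
    (hμ.mono fun _ hs => antitone_coeff_toddLogSeries hs.1.le hs.2 hjk)

theorem meanToddLogCoeff_eq_stirlingTransform (k : ℕ) :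
    meanToddLogCoeff μ k =
      stirlingTransform (fun l => (bernoulli' l : ℝ) * ∫ s, s ^ l ∂μ) k := by
  simp only [meanToddLogCoeff, coeff_toddLogSeries, stirlingTransform]
  rw [integral_div, integral_finsetSum]
  · simp only [integral_const_mul]
  · exact fun l _ => integrable_of_continuousOn_of_ae_mem_Ioc (by fun_prop) hμ

theorem hasSum_meanToddLogCoeff_mul_beta {a : ℝ} (ha : 0 < a) {T : ℝ}
    (hT : HasSum (fun m : ℕ => ∫ s, s / (a + m * s) ^ 2 ∂μ) T) :
    HasSum (fun k : ℕ => meanToddLogCoeff μ k * beta a (k + 1)) T := by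
  simp only [meanToddLogCoeff, ← integral_mul_const]
  refine hasSum_integral_of_hasSum_integral (fun k => ?_) (fun m => ?_)
    (fun k => (integrable_coeff_toddLogSeries hμ k).mul_const _)
    (fun m => integrable_of_continuousOn_of_ae_mem_Ioc ?_ hμ)
    (hμ.mono fun s hs => hasSum_coeff_toddLogSeries_mul_beta hs ha)
    (hμ.mono fun s hs => (summable_div_add_natCast_mul_sq hs.1 ha).hasSum) hT
  · filter_upwards [hμ] with s hs
    exact mul_nonneg (coeff_toddLogSeries_nonneg hs.1.le hs.2 k)
      (beta_pos ha (by positivity)).le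
  · filter_upwards [hμ] with s hs
    have := hs.1
    positivity
  · refine continuousOn_id.div (by fun_prop) fun s hs => ?_
    have := hs.1
    positivity

end Mixture

section BetaLaw

open MeasureTheory ProbabilityTheory

theorem measurable_betaPDF (α β : ℝ) : Measurable (betaPDF α β) :=
  (measurable_betaPDFReal α β).ennreal_ofReal

theorem ae_betaMeasure_mem_Ioo (α β : ℝ) : ∀ᵐ s ∂betaMeasure α β, s ∈ Set.Ioo (0 : ℝ) 1 := by
  rw [betaMeasure, ae_withDensity_iff (measurable_betaPDF α β)]
  refine .of_forall fun s hs => ⟨?_, ?_⟩ <;> contrapose! hs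
  · exact betaPDF_eq_zero_of_nonpos hs
  · exact betaPDF_eq_zero_of_one_le hs

/-- The projective transformation of `[0, 1]` that fixes both endpoints and multiplies
`s / (1 - s)` by `c / a`. -/
noncomputable def unitProjectiveMap (a c s : ℝ) : ℝ :=
  c * s / (a * (1 - s) + c * s)

section ProjectiveMap

variable {a c s : ℝ} (ha : 0 < a) (hc : 0 < c) (hs : s ∈ Set.Ioo (0 : ℝ) 1)
include ha hc hs

theorem mul_one_sub_add_mul_pos : 0 < a * (1 - s) + c * s :=
  add_pos (mul_pos ha (sub_pos.2 hs.2)) (mul_pos hc hs.1)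

theorem one_sub_unitProjectiveMap :
    1 - unitProjectiveMap a c s = a * (1 - s) / (a * (1 - s) + c * s) := by
  rw [unitProjectiveMap, one_sub_div (mul_one_sub_add_mul_pos ha hc hs).ne', add_sub_cancel_right]

theorem unitProjectiveMap_mem_Ioo : unitProjectiveMap a c s ∈ Set.Ioo (0 : ℝ) 1 := by
  have hD := mul_one_sub_add_mul_pos ha hc hs
  refine ⟨div_pos (mul_pos hc hs.1) hD, sub_pos.1 ?_⟩
  rw [one_sub_unitProjectiveMap ha hc hs]
  exact div_pos (mul_pos ha (sub_pos.2 hs.2)) hD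

theorem unitProjectiveMap_swap_apply : unitProjectiveMap c a (unitProjectiveMap a c s) = s := by
  have hD := mul_one_sub_add_mul_pos ha hc hs
  rw [unitProjectiveMap, one_sub_unitProjectiveMap ha hc hs, unitProjectiveMap]
  field_simp
  ring

theorem hasDerivAt_unitProjectiveMap :
    HasDerivAt (unitProjectiveMap a c) (a * c / (a * (1 - s) + c * s) ^ 2) s := by
  have hD := mul_one_sub_add_mul_pos ha hc hs
  have hnum := (hasDerivAt_id s).const_mul c
  have hden := (((hasDerivAt_id s).const_sub 1).const_mul a).add hnum
  refine (hnum.div hden hD.ne').congr_deriv ?_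
  simp only [Pi.add_apply, id]
  ring

end ProjectiveMap

theorem image_unitProjectiveMap_Ioo {a c : ℝ} (ha : 0 < a) (hc : 0 < c) :
    unitProjectiveMap a c '' Set.Ioo 0 1 = Set.Ioo 0 1 :=
  (Set.InvOn.bijOn ⟨fun _ => unitProjectiveMap_swap_apply ha hc,
    fun _ => unitProjectiveMap_swap_apply hc ha⟩ (fun _ => unitProjectiveMap_mem_Ioo ha hc)
    fun _ => unitProjectiveMap_mem_Ioo hc ha).image_eq

section Integrals

variable {α β : ℝ} (hα : 0 < α) (hβ : 0 < β)
include hα hβ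

theorem integral_betaMeasure (f : ℝ → ℝ) :
    ∫ s, f s ∂betaMeasure α β =
      (∫ s in Set.Ioo 0 1, s ^ (α - 1) * (1 - s) ^ (β - 1) * f s) / beta α β := by
  rw [betaMeasure, integral_withDensity_eq_integral_toReal_smul
    (measurable_betaPDF α β) (.of_forall fun _ => ENNReal.ofReal_lt_top),
    ← setIntegral_eq_integral_of_forall_compl_eq_zero (s := Set.Ioo 0 1), ← integral_div]
  · refine setIntegral_congr_fun measurableSet_Ioo fun s hs => ?_
    have := (betaPDFReal_pos hs.1 hs.2 hα hβ).le
    simp only [betaPDF, ENNReal.toReal_ofReal this, smul_eq_mul]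
    rw [betaPDFReal, if_pos (Set.mem_Ioo.1 hs)]
    ring
  · intro s hs
    rw [betaPDF, betaPDFReal, if_neg (mt Set.mem_Ioo.2 hs), ENNReal.ofReal_zero,
      ENNReal.toReal_zero, zero_smul]

theorem integral_rpow_mul_one_sub_rpow :
    ∫ s in Set.Ioo 0 1, s ^ (α - 1) * (1 - s) ^ (β - 1) = beta α β := by
  have := isProbabilityMeasureBeta hα hβ
  have h := integral_betaMeasure hα hβ 1
  simp only [Pi.one_apply, integral_const, probReal_univ, mul_one, smul_eq_mul] at h
  exact ((div_eq_one_iff_eq (beta_pos hα hβ).ne').1 h.symm)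

theorem integral_pow_betaMeasure (l : ℕ) :
    ∫ s, s ^ l ∂betaMeasure α β = beta (α + l) β / beta α β := by
  rw [integral_betaMeasure hα hβ, ← integral_rpow_mul_one_sub_rpow (by positivity : 0 < α + l) hβ]
  congr 1
  refine setIntegral_congr_fun measurableSet_Ioo fun s hs => ?_
  simp only [add_sub_right_comm, Real.rpow_add_natCast hs.1.ne']
  ring

-- Feynman's parametrization of `1 / (a ^ β * c ^ α)`.
theorem integral_rpow_mul_one_sub_rpow_div_rpow {a c : ℝ} (ha : 0 < a) (hc : 0 < c) :
    ∫ s in Set.Ioo 0 1, s ^ (α - 1) * (1 - s) ^ (β - 1) / (a * (1 - s) + c * s) ^ (α + β) =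
      beta α β / (a ^ β * c ^ α) := by
  rw [← integral_rpow_mul_one_sub_rpow hα hβ]
  conv_rhs => rw [← image_unitProjectiveMap_Ioo ha hc]
  rw [integral_image_eq_integral_abs_deriv_smul measurableSet_Ioo
    (fun s hs => (hasDerivAt_unitProjectiveMap ha hc hs).hasDerivWithinAt)
    (Set.LeftInvOn.injOn fun _ => unitProjectiveMap_swap_apply ha hc), ← integral_div]
  refine setIntegral_congr_fun measurableSet_Ioo fun s hs => ?_
  have hs₀ := hs.1
  have hs₁ : 0 < 1 - s := sub_pos.2 hs.2
  have hD := mul_one_sub_add_mul_pos ha hc hs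
  simp only [one_sub_unitProjectiveMap ha hc hs]
  rw [unitProjectiveMap, abs_of_pos (by positivity), Real.div_rpow (by positivity) hD.le,
    Real.div_rpow (by positivity) hD.le, Real.mul_rpow hc.le hs₀.le, Real.mul_rpow ha.le hs₁.le,
    Real.rpow_add hD]
  simp only [Real.rpow_sub_one hD.ne', Real.rpow_sub_one ha.ne', Real.rpow_sub_one hc.ne',
    smul_eq_mul]
  field_simp

end Integrals

theorem integral_pow_betaMeasure_half (l : ℕ) :
    ∫ s, s ^ l ∂betaMeasure (1 / 2) (1 / 2) = (2 * l - 1 : ℕ)‼ / (2 ^ l * l !) := by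
  have hsq : √Real.pi * √Real.pi = Real.pi := Real.mul_self_sqrt Real.pi_pos.le
  have hbeta (l : ℕ) : beta (1 / 2 + l) (1 / 2) =
      Real.pi * ((2 * l - 1 : ℕ)‼ / (2 ^ l * l !)) := by
    rw [beta, add_right_comm, add_halves, add_comm, Real.Gamma_nat_add_half, add_comm 1,
      Real.Gamma_nat_eq_factorial, Real.Gamma_one_half_eq]
    linear_combination ((2 * l - 1 : ℕ)‼ : ℝ) / (2 ^ l * l !) * hsq
  have hbeta₀ : beta (1 / 2) (1 / 2) = Real.pi := by simpa using hbeta 0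
  rw [integral_pow_betaMeasure one_half_pos one_half_pos, hbeta, hbeta₀,
    mul_div_cancel_left₀ _ Real.pi_ne_zero]

theorem integral_div_sq_betaMeasure_half {a b : ℝ} (ha : 0 < a) (hab : 0 < a + b) :
    ∫ s, s / (a + b * s) ^ 2 ∂betaMeasure (1 / 2) (1 / 2) =
      1 / (2 * √a) * (1 / ((a + b) * √(a + b))) := by
  have hbeta : beta (3 / 2) (1 / 2) / beta (1 / 2) (1 / 2) = 1 / 2 := by
    have h := integral_pow_betaMeasure one_half_pos one_half_pos 1
    rw [integral_pow_betaMeasure_half] at h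
    norm_num at h
    norm_num [← h]
  have hint : ∫ s in Set.Ioo 0 1,
      s ^ ((1 : ℝ) / 2 - 1) * (1 - s) ^ ((1 : ℝ) / 2 - 1) * (s / (a + b * s) ^ 2) =
      beta (3 / 2) (1 / 2) / (√a * ((a + b) * √(a + b))) := by
    have h := integral_rpow_mul_one_sub_rpow_div_rpow (α := 3 / 2) (β := 1 / 2) (by norm_num)
      one_half_pos ha hab
    rw [(by norm_num : (3 : ℝ) / 2 = 1 + 1 / 2), Real.rpow_add hab, Real.rpow_one,
      ← Real.sqrt_eq_rpow, ← Real.sqrt_eq_rpow] at h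
    rw [(by norm_num : (3 : ℝ) / 2 = 1 + 1 / 2), ← h]
    refine setIntegral_congr_fun measurableSet_Ioo fun s hs => ?_
    have hs₀ := hs.1
    have hD : a * (1 - s) + (a + b) * s = a + b * s := by ring
    simp only [add_sub_right_comm, sub_self, zero_add, add_assoc, add_halves, one_add_one_eq_two,
      Real.rpow_two, Real.rpow_sub_one hs₀.ne', hD]
    field_simp
  rw [integral_betaMeasure one_half_pos one_half_pos, hint, div_right_comm, hbeta]
  field_simp

end BetaLaw

section BetaSeries

open Filter Topology ProbabilityTheory

theorem eq_zero_of_tendsto_natCast_mul_of_summable {v : ℕ → ℝ} {L : ℝ} (hv : Summable v)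
    (hL : Tendsto (fun k : ℕ => k * v k) atTop (𝓝 L)) : L = 0 := by
  by_contra hL₀
  have one_isBigO : (fun _ => L) =O[atTop] fun k : ℕ => k * v k :=
    ((Asymptotics.isEquivalent_const_iff_tendsto hL₀).2 hL).symm.isBigO
  have harmonic_isBigO : (fun k : ℕ => 1 / (k : ℝ) * L) =O[atTop] v :=
    ((Asymptotics.isBigO_refl (fun k : ℕ => 1 / (k : ℝ)) atTop).mul one_isBigO).trans_eventuallyEq
      (by
        filter_upwards [eventually_ne_atTop 0] with k hk
        field_simp)
  exact Real.not_summable_one_div_natCast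
    ((summable_mul_right_iff hL₀).1 (summable_of_isBigO_nat hv harmonic_isBigO))

theorem tendsto_beta_natCast_add_one {a : ℝ} (ha : 0 < a) :
    Tendsto (fun k : ℕ => beta a (k + 1)) atTop (𝓝 0) := by
  have gammaSeq_div : Tendsto (fun k : ℕ => Real.GammaSeq a k * (k : ℝ) ^ (-a)) atTop (𝓝 0) := by
    simpa using (Real.GammaSeq_tendsto_Gamma a).mul
      ((tendsto_rpow_neg_atTop ha).comp tendsto_natCast_atTop_atTop)
  refine gammaSeq_div.congr' ?_
  filter_upwards [eventually_gt_atTop 0] with k hk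
  have hk' : (0 : ℝ) < k := Nat.cast_pos.2 hk
  have hpow := (Real.rpow_pos_of_pos hk' a).ne'
  rw [Real.GammaSeq, beta_natCast_add_one ha, Real.rpow_neg hk'.le, Finset.range_eq_Ico,
    Finset.prod_eq_prod_Ico_succ_bot k.succ_pos, Nat.cast_zero, add_zero]
  field_simp
  rfl

theorem hasSum_beta_natCast_add_two_div {a : ℝ} (ha : 0 < a) :
    HasSum (fun k : ℕ => beta a (k + 2) / (k + 1)) (1 / a ^ 2) := by
  have telescope (k : ℕ) :
      beta a (k + 2) / (k + 1) = (beta a ((k : ℕ) + 1) - beta a ((k + 1 : ℕ) + 1)) / a := by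
    have h := add_mul_beta_add_one ha (Nat.cast_add_one_pos k : (0 : ℝ) < k + 1)
    rw [add_assoc, one_add_one_eq_two] at h
    push_cast
    rw [add_assoc (k : ℝ), one_add_one_eq_two]
    field_simp
    linarith
  have partial_sums : Tendsto (fun n : ℕ => (beta a ((0 : ℕ) + 1) - beta a (n + 1)) / a) atTop
      (𝓝 (1 / a ^ 2)) := by
    have h := ((tendsto_beta_natCast_add_one ha).const_sub (beta a ((0 : ℕ) + 1))).div_const a
    convert h using 2
    rw [Nat.cast_zero, zero_add, beta_one_right ha]
    field_simp
    simp
  rw [hasSum_iff_tendsto_nat_of_nonneg fun k => by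
    have := beta_pos ha (by positivity : (0 : ℝ) < k + 2)
    positivity]
  simpa only [telescope, ← Finset.sum_div,
    Finset.sum_range_sub' fun k : ℕ => beta a ((k : ℝ) + 1)] using partial_sums

theorem sum_range_sub_mul_beta {a : ℝ} (ha : 0 < a) (u : ℕ → ℝ) (n : ℕ) :
    ∑ k ∈ Finset.range n, ((k + 1) * u (k + 1) - k * u k) * beta a (k + 1) =
      a * ∑ k ∈ Finset.range n, u (k + 1) * beta a ((k + 1 : ℕ) + 1) +
        n * (u n * beta a (n + 1)) := by
  induction n with
  | zero => simp
  | succ n ih =>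
    have h := add_mul_beta_add_one ha (Nat.cast_add_one_pos n : (0 : ℝ) < n + 1)
    rw [Finset.sum_range_succ, ih, Finset.sum_range_succ]
    push_cast
    linear_combination -u (n + 1) * h

theorem summable_sub_mul_beta_of_antitone {u : ℕ → ℝ} {a : ℝ} (ha : 0 < a) (hu₀ : ∀ k, 0 ≤ u k)
    (hu : Antitone u) (hs : Summable fun k : ℕ => u k * beta a (k + 1)) :
    Summable fun k : ℕ => ((k + 1) * u (k + 1) - k * u k) * beta a (k + 1) := by
  have hβ (k : ℕ) : 0 < beta a (k + 1) := beta_pos ha (by positivity)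
  have hv₀ (k : ℕ) : 0 ≤ u k * beta a (k + 1) := mul_nonneg (hu₀ k) (hβ k).le
  suffices summable_gap : Summable fun k : ℕ => ((k + 1) * (u k - u (k + 1))) * beta a (k + 1) by
    exact (hs.sub summable_gap).congr fun k => by ring
  refine summable_of_sum_range_le (c := ∑' k : ℕ, u k * beta a (k + 1)) (fun k => ?_) fun n => ?_
  · exact mul_nonneg (mul_nonneg (Nat.cast_add_one_pos k).le (sub_nonneg.2 (hu k.le_succ)))
      (hβ k).le
  calc ∑ k ∈ Finset.range n, ((k + 1) * (u k - u (k + 1))) * beta a (k + 1)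
      = ∑ k ∈ Finset.range n, u k * beta a (k + 1) -
          ∑ k ∈ Finset.range n, ((k + 1) * u (k + 1) - k * u k) * beta a (k + 1) := by
        rw [← Finset.sum_sub_distrib]
        exact Finset.sum_congr rfl fun k _ => by ring
    _ ≤ ∑ k ∈ Finset.range n, u k * beta a (k + 1) := by
        rw [sum_range_sub_mul_beta ha, sub_le_self_iff]
        have := Finset.sum_nonneg fun k (_ : k ∈ Finset.range n) => hv₀ (k + 1)
        have := hv₀ n
        positivity
    _ ≤ ∑' k : ℕ, u k * beta a (k + 1) := hs.sum_le_tsum _ fun k _ => hv₀ k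

theorem hasSum_sub_mul_beta_of_antitone {u : ℕ → ℝ} {a T : ℝ} (ha : 0 < a) (hu₀ : ∀ k, 0 ≤ u k)
    (hu : Antitone u) (hT : HasSum (fun k : ℕ => u k * beta a (k + 1)) T) :
    HasSum (fun k : ℕ => ((k + 1) * u (k + 1) - k * u k) * beta a (k + 1)) (a * T - u 0) := by
  have hd := (summable_sub_mul_beta_of_antitone ha hu₀ hu hT.summable).hasSum
  have hT' : HasSum (fun k : ℕ => u (k + 1) * beta a ((k + 1 : ℕ) + 1)) (T - u 0 / a) := by
    simpa [beta_one_right ha, div_eq_mul_inv] using (hasSum_nat_add_iff' 1).2 hT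
  -- The partial sums differ by `n * (u n * beta a (n + 1))`, so this boundary term converges.
  have boundary := hd.tendsto_sum_nat.sub (hT'.tendsto_sum_nat.const_mul a)
  simp only [sum_range_sub_mul_beta ha, add_sub_cancel_left] at boundary
  have hsum := sub_eq_zero.1 (eq_zero_of_tendsto_natCast_mul_of_summable hT.summable boundary)
  rw [hsum] at hd
  convert hd using 1
  field_simp

end BetaSeries

section ArcsineCoefficients

open MeasureTheory ProbabilityTheory

theorem isProbabilityMeasure_betaMeasure_half :
    IsProbabilityMeasure (betaMeasure (1 / 2) (1 / 2)) :=
  isProbabilityMeasureBeta (by norm_num) (by norm_num)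

theorem ae_betaMeasure_mem_Ioc (α β : ℝ) : ∀ᵐ s ∂betaMeasure α β, s ∈ Set.Ioc 0 1 :=
  (ae_betaMeasure_mem_Ioo α β).mono fun _ hs => Set.Ioo_subset_Ioc_self hs

/-- The coefficients of the expansion in powers of `x` of `v / (1 - e ^ (-v))` at
`v = -s log (1 - x)`, averaged over `s` distributed by the arcsine law `Beta (1/2, 1/2)`. -/
noncomputable def arcsineToddCoeff : ℕ → ℝ :=
  meanToddLogCoeff (betaMeasure (1 / 2) (1 / 2))

theorem arcsineToddCoeff_eq_stirlingTransform (k : ℕ) :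
    arcsineToddCoeff k =
      stirlingTransform (fun l => (bernoulli' l : ℝ) * ((2 * l - 1 : ℕ)‼ / (2 ^ l * l !))) k := by
  have := isProbabilityMeasure_betaMeasure_half
  simp only [arcsineToddCoeff, meanToddLogCoeff_eq_stirlingTransform (ae_betaMeasure_mem_Ioc _ _),
    integral_pow_betaMeasure_half]

theorem arcsineToddCoeff_nonneg (k : ℕ) : 0 ≤ arcsineToddCoeff k :=
  meanToddLogCoeff_nonneg (ae_betaMeasure_mem_Ioc _ _) k

theorem antitone_arcsineToddCoeff : Antitone arcsineToddCoeff :=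
  have := isProbabilityMeasure_betaMeasure_half
  antitone_meanToddLogCoeff (ae_betaMeasure_mem_Ioc _ _)

theorem arcsineToddCoeff_zero : arcsineToddCoeff 0 = 1 := by
  simp [arcsineToddCoeff_eq_stirlingTransform, stirlingTransform_zero]

theorem arcsineToddCoeff_one : arcsineToddCoeff 1 = 1 / 4 := by
  rw [arcsineToddCoeff_eq_stirlingTransform, stirlingTransform_one]
  norm_num

theorem hasSum_arcsineToddCoeff_mul_beta {a Z : ℝ} (ha : 0 < a)
    (hZ : HasSum (fun m : ℕ => 1 / ((a + m) * √(a + m))) Z) :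
    HasSum (fun k : ℕ => arcsineToddCoeff k * beta a (k + 1)) (1 / (2 * √a) * Z) := by
  have := isProbabilityMeasure_betaMeasure_half
  refine hasSum_meanToddLogCoeff_mul_beta (ae_betaMeasure_mem_Ioc _ _) ha ?_
  have integral_eq (m : ℕ) := integral_div_sq_betaMeasure_half ha (by positivity : 0 < a + m)
  simpa only [integral_eq] using hZ.mul_left (1 / (2 * √a))

theorem neg_one_pow_mul_stirlingFirstSigned (k l : ℕ) :
    (-1 : ℝ) ^ (k + 1) * ((-1) ^ l * (stirlingFirstSigned k l : ℝ)) = -Nat.stirlingFirst k l := by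
  have hsign : ((-1 : ℝ) ^ (k + l)) * (-1) ^ (k + l) = 1 := by rw [← mul_pow]; simp
  rw [stirlingFirstSigned]
  push_cast
  linear_combination -(Nat.stirlingFirst k l : ℝ) * hsign

theorem zetaThreeHalvesCoeffA_succ (k : ℕ) :
    (zetaThreeHalvesCoeffA (k + 1) : ℝ) =
      -((k + 1)! * (((k + 1 : ℕ) + 1) * arcsineToddCoeff (k + 2) -
        (k + 1 : ℕ) * arcsineToddCoeff (k + 1))) := by
  rw [arcsineToddCoeff_eq_stirlingTransform, arcsineToddCoeff_eq_stirlingTransform,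
    stirlingTransform_succ, add_sub_cancel_left, ← sum_Icc_one_stirlingFirst_mul,
    zetaThreeHalvesCoeffA, ← Finset.sum_neg_distrib]
  push_cast
  rw [Finset.mul_sum]
  refine Finset.sum_congr rfl fun l hl => ?_
  rw [bernoulli_eq_bernoulli'_of_ne_one (by have := (Finset.mem_Icc.1 hl).1; lia),
    show 2 * (l + 1) - 1 = 2 * l + 1 by lia]
  linear_combination ((bernoulli' (l + 1) : ℝ) *
    ((2 * l + 1)‼ / (2 ^ (l + 1) * (l + 1)!))) * neg_one_pow_mul_stirlingFirstSigned (k + 1) l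

theorem zetaThreeHalvesCoeffB_succ (k : ℕ) :
    (zetaThreeHalvesCoeffB (k + 1) : ℝ) =
      -((k + 1)! * (arcsineToddCoeff (k + 1) - 1 / 2 / (k + 1))) := by
  have half : (1 / 2 : ℝ) = (2 * 1 - 1 : ℕ)‼ / (2 ^ 1 * 1 !) := by norm_num
  rw [arcsineToddCoeff_eq_stirlingTransform, half,
    ← stirlingTransform_bernoulli_mul fun l => ((2 * l - 1 : ℕ)‼ / (2 ^ l * l !) : ℝ),
    ← sum_Icc_one_stirlingFirst_mul, zetaThreeHalvesCoeffB, ← Finset.sum_neg_distrib]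
  push_cast
  rw [Finset.mul_sum]
  refine Finset.sum_congr rfl fun l _ => ?_
  linear_combination ((bernoulli l : ℝ) * ((2 * l - 1 : ℕ)‼ / (2 ^ l * l !))) *
    neg_one_pow_mul_stirlingFirstSigned (k + 1) l

theorem zetaThreeHalvesTermA_succ {n : ℕ} (hn : 0 < n) (k : ℕ) :
    zetaThreeHalvesTermA n (k + 1) =
      -((((k + 1 : ℕ) + 1) * arcsineToddCoeff (k + 2) - (k + 1 : ℕ) * arcsineToddCoeff (k + 1)) *
        beta n ((k + 1 : ℕ) + 1)) := by
  rw [zetaThreeHalvesTermA, zetaThreeHalvesCoeffA_succ, beta_natCast_add_one (Nat.cast_pos.2 hn)]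
  ring

theorem zetaThreeHalvesTermB_succ {n : ℕ} (hn : 0 < n) (k : ℕ) :
    zetaThreeHalvesTermB n (k + 1) =
      -√(n : ℝ) * (arcsineToddCoeff (k + 1) * beta n ((k + 1 : ℕ) + 1) -
        1 / 2 * (beta n (k + 2) / (k + 1))) := by
  have hn' : (0 : ℝ) < n := Nat.cast_pos.2 hn
  have : 0 < ∏ i ∈ Finset.Icc 1 (k + 1), ((n : ℝ) + i) :=
    Finset.prod_pos fun i _ => by positivity
  have hβ : beta (n : ℝ) (k + 2) = beta n ((k + 1 : ℕ) + 1) := by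
    congr 1
    push_cast
    ring
  have hsqrt := Real.mul_self_sqrt hn'.le
  have := Real.sqrt_pos.2 hn'
  rw [zetaThreeHalvesTermB, zetaThreeHalvesCoeffB_succ, hβ, beta_natCast_add_one hn',
    div_eq_iff (by positivity)]
  field_simp
  linear_combination (2 * arcsineToddCoeff (k + 1) * (k + 1) - 1) * hsqrt

end ArcsineCoefficients

section Series

open ProbabilityTheory

theorem natCast_mul_sqrt_eq_rpow (k : ℕ) : (k : ℝ) * √(k : ℝ) = (k : ℝ) ^ (3 / 2 : ℝ) := by
  rw [show (3 / 2 : ℝ) = 1 + 1 / 2 by norm_num, Real.rpow_add' k.cast_nonneg (by norm_num),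
    Real.rpow_one, ← Real.sqrt_eq_rpow]

theorem summable_one_div_natCast_mul_sqrt : Summable fun k : ℕ => 1 / ((k : ℝ) * √(k : ℝ)) := by
  simpa only [natCast_mul_sqrt_eq_rpow] using Real.summable_one_div_nat_rpow.2 (by norm_num)

theorem riemannZeta_three_halves :
    riemannZeta (3 / 2) = ((∑' k : ℕ, 1 / ((k : ℝ) * √(k : ℝ)) : ℝ) : ℂ) := by
  rw [zeta_eq_tsum_one_div_nat_cpow (by norm_num), Complex.ofReal_tsum]
  refine tsum_congr fun k => ?_
  rw [natCast_mul_sqrt_eq_rpow, Complex.ofReal_div, Complex.ofReal_cpow k.cast_nonneg]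
  push_cast
  rfl

/-- The remainder `∑ 1 / (k * √k)`, over `k ≥ n`, of the series for `ζ(3/2)`. -/
noncomputable def zetaThreeHalvesTail (n : ℕ) : ℝ :=
  ∑' m : ℕ, 1 / (((m + n : ℕ) : ℝ) * √((m + n : ℕ) : ℝ))

theorem hasSum_zetaThreeHalvesTail (n : ℕ) :
    HasSum (fun m : ℕ => 1 / (((n : ℝ) + m) * √((n : ℝ) + m))) (zetaThreeHalvesTail n) := by
  simpa only [zetaThreeHalvesTail, Nat.cast_add, add_comm] using
    ((summable_nat_add_iff n).2 summable_one_div_natCast_mul_sqrt).hasSum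

theorem sum_Icc_one_div_mul_sqrt_eq_riemannZeta_sub_tail {n : ℕ} (hn : 0 < n) :
    ((∑ k ∈ Finset.Icc 1 n, 1 / ((k : ℝ) * √(k : ℝ)) : ℝ) : ℂ) =
      riemannZeta (3 / 2) + ((1 / (n * √(n : ℝ)) - zetaThreeHalvesTail n : ℝ) : ℂ) := by
  have split := summable_one_div_natCast_mul_sqrt.sum_add_tsum_nat_add n
  rw [Finset.range_eq_Ico, Finset.sum_eq_sum_Ico_succ_bot hn, Nat.cast_zero, zero_mul, div_zero,
    zero_add] at split
  rw [riemannZeta_three_halves, ← Complex.ofReal_add, ← split, zetaThreeHalvesTail,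
    ← Finset.Ico_add_one_right_eq_Icc, Finset.sum_Ico_succ_top (by lia)]
  congr 1
  ring

theorem hasSum_zetaThreeHalvesTermA {n : ℕ} (hn : 0 < n) :
    HasSum (fun j => zetaThreeHalvesTermA n (j + 1))
      (1 + 1 / (4 * n) - √(n : ℝ) / 2 * zetaThreeHalvesTail n) := by
  have hn' : (0 : ℝ) < n := Nat.cast_pos.2 hn
  have hsum := hasSum_sub_mul_beta_of_antitone hn' arcsineToddCoeff_nonneg
    antitone_arcsineToddCoeff
    (hasSum_arcsineToddCoeff_mul_beta hn' (hasSum_zetaThreeHalvesTail n))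
  have hsum_succ := ((hasSum_nat_add_iff' 1).2 hsum).neg
  simp only [zetaThreeHalvesTermA_succ hn]
  convert! hsum_succ using 1
  have hs := Real.sqrt_pos.2 hn'
  have hsq := Real.sq_sqrt hn'.le
  rw [Finset.sum_range_one, Nat.cast_zero, zero_add, zero_add, zero_mul, sub_zero, one_mul,
    beta_one_right hn', arcsineToddCoeff_zero, arcsineToddCoeff_one]
  generalize √(n : ℝ) = s at hs hsq
  rw [← hsq]
  field_simp
  ring

theorem hasSum_zetaThreeHalvesTermB {n : ℕ} (hn : 0 < n) :
    HasSum (fun j => zetaThreeHalvesTermB n (j + 1))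
      (1 / √(n : ℝ) + 1 / (2 * n * √(n : ℝ)) - 1 / 2 * zetaThreeHalvesTail n) := by
  have hn' : (0 : ℝ) < n := Nat.cast_pos.2 hn
  have hsum_succ := (hasSum_nat_add_iff' 1).2
    (hasSum_arcsineToddCoeff_mul_beta hn' (hasSum_zetaThreeHalvesTail n))
  have hsum := (hsum_succ.sub ((hasSum_beta_natCast_add_two_div hn').mul_left (1 / 2))).mul_left
    (-√(n : ℝ))
  simp only [zetaThreeHalvesTermB_succ hn]
  convert! hsum using 1
  have hs := Real.sqrt_pos.2 hn'
  have hsq := Real.sq_sqrt hn'.le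
  rw [Finset.sum_range_one, Nat.cast_zero, zero_add, beta_one_right hn', arcsineToddCoeff_zero]
  generalize √(n : ℝ) = s at hs hsq
  rw [← hsq]
  field_simp
  ring

end Series

section Values

theorem zetaThreeHalvesCoeffA_values :
    2 * zetaThreeHalvesCoeffA 1 = -(1 / 8) ∧ 2 * zetaThreeHalvesCoeffA 2 = -(1 / 8) ∧
      2 * zetaThreeHalvesCoeffA 3 = -(89 / 384) ∧ 2 * zetaThreeHalvesCoeffA 4 = -(41 / 64) := by
  have bernoulli'_five : bernoulli' 5 = 0 := bernoulli'_eq_zero_of_odd (by decide) (by norm_num)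
  refine ⟨?_, ?_, ?_, ?_⟩ <;>
  simp [zetaThreeHalvesCoeffA, stirlingFirstSigned, Finset.sum_Icc_succ_top, Nat.stirlingFirst,
    Nat.doubleFactorial, Nat.factorial, bernoulli_eq_bernoulli'_of_ne_one, bernoulli'_five] <;>
  norm_num

theorem zetaThreeHalvesCoeffB_values :
    2 * zetaThreeHalvesCoeffB 1 = 1 / 2 ∧ 2 * zetaThreeHalvesCoeffB 2 = 3 / 8 ∧
      2 * zetaThreeHalvesCoeffB 3 = 5 / 8 ∧ 2 * zetaThreeHalvesCoeffB 4 = 631 / 384 := by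
  refine ⟨?_, ?_, ?_, ?_⟩ <;>
  simp [zetaThreeHalvesCoeffB, stirlingFirstSigned, Finset.sum_Icc_succ_top, Nat.stirlingFirst,
    Nat.doubleFactorial, Nat.factorial, bernoulli_eq_bernoulli'_of_ne_one] <;>
  norm_num

end Values

theorem mainTheorem7 :
    (∀ n : ℕ, 1 ≤ n →
      Summable (fun j : ℕ => zetaThreeHalvesTermA n (j + 1)) ∧
      ((∑ k ∈ Finset.Icc 1 n, 1 / ((k : ℝ) * √(k : ℝ)) : ℝ) : ℂ) =
        riemannZeta (3 / 2) +
          ((-(2 / √(n : ℝ)) + 1 / (2 * (n : ℝ) * √(n : ℝ)) +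
            2 / √(n : ℝ) * ∑' j : ℕ, zetaThreeHalvesTermA n (j + 1) : ℝ) : ℂ)) ∧
    (2 * zetaThreeHalvesCoeffA 1 = -(1 / 8) ∧ 2 * zetaThreeHalvesCoeffA 2 = -(1 / 8) ∧
      2 * zetaThreeHalvesCoeffA 3 = -(89 / 384) ∧ 2 * zetaThreeHalvesCoeffA 4 = -(41 / 64)) ∧
    (∀ n : ℕ, 1 ≤ n →
      Summable (fun j : ℕ => zetaThreeHalvesTermB n (j + 1)) ∧
      ((∑ k ∈ Finset.Icc 1 n, 1 / ((k : ℝ) * √(k : ℝ)) : ℝ) : ℂ) =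
        riemannZeta (3 / 2) +
          ((-(2 / √(n : ℝ)) +
            2 * ∑' j : ℕ, zetaThreeHalvesTermB n (j + 1) : ℝ) : ℂ)) ∧
    (2 * zetaThreeHalvesCoeffB 1 = 1 / 2 ∧ 2 * zetaThreeHalvesCoeffB 2 = 3 / 8 ∧
      2 * zetaThreeHalvesCoeffB 3 = 5 / 8 ∧ 2 * zetaThreeHalvesCoeffB 4 = 631 / 384) := by
  refine ⟨fun n hn => ?_, zetaThreeHalvesCoeffA_values, fun n hn => ?_,
    zetaThreeHalvesCoeffB_values⟩
  · have hsum := hasSum_zetaThreeHalvesTermA hn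
    refine ⟨hsum.summable, ?_⟩
    rw [sum_Icc_one_div_mul_sqrt_eq_riemannZeta_sub_tail hn, hsum.tsum_eq]
    congr 2
    field_simp
    ring
  · have hsum := hasSum_zetaThreeHalvesTermB hn
    refine ⟨hsum.summable, ?_⟩
    rw [sum_Icc_one_div_mul_sqrt_eq_riemannZeta_sub_tail hn, hsum.tsum_eq]
    congr 2
    ring
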